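/- Let $F\in\mathbb R[x,y]$ be irreducible, let $C\subset\mathbb A^2$ be the plane curve over $\mathbb R$ with equation $F=0$, and let $\pi\colon X\to C$ be its normalization, so that $\mathbb R[X]$ is the integral closure of $\mathbb R[C]=\mathbb R[x,y]/(F)$ in its field of fractions. Let $\xi\in X(\mathbb R)$ be a real point, $\eta=\pi(\xi)\in C(\mathbb R)$, and let $A_\xi=\mathcal O_{X,\xi}$ be the local ring of $X$ at $\xi$, a discrete valuation ring with valuation $\mathrm{val}_\xi$. Consider $x,y$ as elements of $A_\xi$. For $f\in A_\xi$ write $\delta(f)=f\otimes1-1\otimes f\in A_\xi\otimes_{\mathbb R}A_\xi$. For $\alpha\in A_\xi\otimes_{\mathbb R}A_\xi$ let $\overline\alpha\in\mathbb R$ be the value of $\alpha$ at $(\xi,\xi)$, that is, the image of $\alpha$ under the multiplication map $A_\xi\otimes_{\mathbb R}A_\xi\to A_\xi$ followed by evaluation at $\xi$. Assume that $\eta$ is a nonsingular point of $C$ (the gradient of $F$ at $\eta$ is nonzero) and that the tangent of $C$ at $\eta$ is simple (it meets $C$ at $\eta$ with intersection multiplicity exactly $2$; in particular, $C$ is not a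 line). Then the set of values $\mathrm{val}_\xi(f)$ of the nonzero elements $f\in\mathbb R+\mathbb Rx+\mathbb Ry$ is $\{0,m,n\}$ with $(m,n)=(1,2)$. Moreover, let $s\in A_\xi$ be any element such that the $A_\xi$-module $\Omega_{A_\xi/\mathbb R}$ is freely generated by $ds$, define $\frac{dx}{ds},\frac{dy}{ds}\in A_\xi$ by $dx=\frac{dx}{ds}\,ds$ and $dy=\frac{dy}{ds}\,ds$, and let $$T=\Bigl(1\otimes\frac{dx}{ds}\Bigr)\,\delta(y)-\Bigl(1\otimes\frac{dy}{ds}\Bigr)\,\delta(x)\ \in\ A_\xi\otimes_{\mathbb R}A_\xi$$ be the tangent tensor of $C$ relative to $s$. Then, for at least one choice of the sign $\pm$, there exist $u_1,u_2\in A_\xi$ and $\alpha,\beta\in A_\xi\otimes_{\mathbb R}A_\xi$ with $$\pm T=\alpha\,\delta(u_1)^2+\beta\,\delta(u_2)^2,\qquad \overline\alpha>0,\quad\overline\beta>0.$$ -/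

import Mathlib

open scoped TensorProduct

noncomputable section

namespace PlaneCurve

/-! ### Tensors over a real algebra -/

section Tensor

variable {A : Type*} [CommRing A] [Algebra ℝ A]

/-- `δ(f) = f ⊗ 1 - 1 ⊗ f`. -/
def delta (f : A) : A ⊗[ℝ] A := f ⊗ₜ[ℝ] (1 : A) - (1 : A) ⊗ₜ[ℝ] f

/-- The module `Ω` of Kähler differentials of `A` over `ℝ` is freely generated by `ds`. -/
def IsFreeGenerator (s : A) : Prop :=
  ∀ ω : Ω[A⁄ℝ], ∃! c : A, ω = c • KaehlerDifferential.D ℝ A s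

/-- The derivative `df/ds`: the unique element of `A` with `df = (df/ds) ds`. -/
def derivWrt {s : A} (hs : IsFreeGenerator s) (f : A) : A :=
  (hs (KaehlerDifferential.D ℝ A f)).choose

theorem derivWrt_spec {s : A} (hs : IsFreeGenerator s) (f : A) :
    KaehlerDifferential.D ℝ A f = derivWrt hs f • KaehlerDifferential.D ℝ A s :=
  (hs (KaehlerDifferential.D ℝ A f)).choose_spec.1

/-- The tangent tensor `T_s(x, y) = (dx/ds) δ(y) - (dy/ds) δ(x)`, where `A` acts on `A ⊗ A`
through the second factor. -/
def tangentTensor {s : A} (hs : IsFreeGenerator s) (x y : A) : A ⊗[ℝ] A :=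
  ((1 : A) ⊗ₜ[ℝ] derivWrt hs x) * delta y - ((1 : A) ⊗ₜ[ℝ] derivWrt hs y) * delta x

end Tensor

/-! ### The curve, its normalization, and local rings at real points -/

/-- The affine coordinate ring `ℝ[C]` of the plane curve `C` with equation `F = 0`. -/
def CoordRing (F : MvPolynomial (Fin 2) ℝ) : Type :=
  MvPolynomial (Fin 2) ℝ ⧸ Ideal.span {F}

instance (F : MvPolynomial (Fin 2) ℝ) : CommRing (CoordRing F) :=
  inferInstanceAs (CommRing (MvPolynomial (Fin 2) ℝ ⧸ Ideal.span {F}))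

instance (F : MvPolynomial (Fin 2) ℝ) : Algebra ℝ (CoordRing F) :=
  inferInstanceAs (Algebra ℝ (MvPolynomial (Fin 2) ℝ ⧸ Ideal.span {F}))

/-- The residue class in `ℝ[C]` of a polynomial. -/
def CoordRing.mk (F : MvPolynomial (Fin 2) ℝ) : MvPolynomial (Fin 2) ℝ →ₐ[ℝ] CoordRing F :=
  Ideal.Quotient.mkₐ ℝ (Ideal.span {F})

/-- The coordinate ring `ℝ[X]` of the normalization `X` of `C` (for irreducible `F`): the integral
closure of `ℝ[C]` in its field of fractions. -/
def NormRing (F : MvPolynomial (Fin 2) ℝ) : Type :=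
  integralClosure (CoordRing F) (FractionRing (CoordRing F))

instance (F : MvPolynomial (Fin 2) ℝ) : CommRing (NormRing F) :=
  inferInstanceAs (CommRing (integralClosure (CoordRing F) (FractionRing (CoordRing F))))

instance (F : MvPolynomial (Fin 2) ℝ) : Algebra (CoordRing F) (NormRing F) :=
  inferInstanceAs
    (Algebra (CoordRing F) (integralClosure (CoordRing F) (FractionRing (CoordRing F))))

instance (F : MvPolynomial (Fin 2) ℝ) : Algebra ℝ (NormRing F) :=
  inferInstanceAs (Algebra ℝ (integralClosure (CoordRing F) (FractionRing (CoordRing F))))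

instance (F : MvPolynomial (Fin 2) ℝ) : IsScalarTower ℝ (CoordRing F) (NormRing F) :=
  inferInstanceAs (IsScalarTower ℝ (CoordRing F)
    (integralClosure (CoordRing F) (FractionRing (CoordRing F))))

/-- The affine coordinates `x` (for `i = 0`) and `y` (for `i = 1`) of the plane, as elements
of `ℝ[X]`. -/
def coord (F : MvPolynomial (Fin 2) ℝ) (i : Fin 2) : NormRing F :=
  algebraMap (CoordRing F) (NormRing F) (CoordRing.mk F (MvPolynomial.X i))

/-- A real point of `X` is a homomorphism `ℝ[X] → ℝ` of `ℝ`-algebras. -/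
abbrev RealPoint (F : MvPolynomial (Fin 2) ℝ) : Type := NormRing F →ₐ[ℝ] ℝ

variable {F : MvPolynomial (Fin 2) ℝ}

/-- The image `η = π(ξ)` of `ξ` under the normalization map, as a point of `ℝ²`. -/
def RealPoint.image (ξ : RealPoint F) : Fin 2 → ℝ := fun i => ξ (coord F i)

instance RealPoint.ker_isPrime (ξ : RealPoint F) : (RingHom.ker ξ).IsPrime :=
  RingHom.ker_isPrime ξ

/-- The local ring of `X` at `ξ`. -/
def RealPoint.LocalRing (ξ : RealPoint F) : Type :=
  Localization.AtPrime (RingHom.ker ξ)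

instance (ξ : RealPoint F) : CommRing ξ.LocalRing :=
  inferInstanceAs (CommRing (Localization.AtPrime (RingHom.ker ξ)))

instance (ξ : RealPoint F) : Algebra (NormRing F) ξ.LocalRing :=
  inferInstanceAs (Algebra (NormRing F) (Localization.AtPrime (RingHom.ker ξ)))

instance (ξ : RealPoint F) : Algebra ℝ ξ.LocalRing :=
  inferInstanceAs (Algebra ℝ (Localization.AtPrime (RingHom.ker ξ)))

instance (ξ : RealPoint F) : IsScalarTower ℝ (NormRing F) ξ.LocalRing :=
  inferInstanceAs (IsScalarTower ℝ (NormRing F) (Localization.AtPrime (RingHom.ker ξ)))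

instance (ξ : RealPoint F) : IsLocalization.AtPrime ξ.LocalRing (RingHom.ker ξ) :=
  inferInstanceAs
    (IsLocalization.AtPrime (Localization.AtPrime (RingHom.ker ξ)) (RingHom.ker ξ))

instance (ξ : RealPoint F) : IsLocalRing ξ.LocalRing :=
  inferInstanceAs (IsLocalRing (Localization.AtPrime (RingHom.ker ξ)))

/-- The coordinate functions as elements of the local ring at `ξ`. -/
def RealPoint.localCoord (ξ : RealPoint F) (i : Fin 2) : ξ.LocalRing :=
  algebraMap (NormRing F) ξ.LocalRing (coord F i)

/-- The evaluation at `ξ` on the local ring at `ξ`. -/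
def RealPoint.eval (ξ : RealPoint F) : ξ.LocalRing →ₐ[ℝ] ℝ :=
  IsLocalization.liftAlgHom (M := (RingHom.ker ξ).primeCompl) (f := ξ)
    (fun g => isUnit_iff_ne_zero.mpr fun h => g.2 (RingHom.mem_ker.mpr h))

/-- The evaluation at `(ξ, ξ)`: multiplication followed by evaluation at `ξ`. -/
def RealPoint.residue (ξ : RealPoint F) : ξ.LocalRing ⊗[ℝ] ξ.LocalRing →ₐ[ℝ] ℝ :=
  ξ.eval.comp (Algebra.TensorProduct.lmul' ℝ)

/-- `val_ξ(f) = k`, where `val_ξ` is the valuation of the discrete valuation ring at `ξ`: `f` lies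
in the `k`-th power of the maximal ideal, but not in the next one. -/
def RealPoint.HasVal (ξ : RealPoint F) (f : ξ.LocalRing) (k : ℕ) : Prop :=
  f ∈ IsLocalRing.maximalIdeal ξ.LocalRing ^ k ∧
    f ∉ IsLocalRing.maximalIdeal ξ.LocalRing ^ (k + 1)

/-- The set of values `val_ξ(f)` of the nonzero elements `f` of `ℝ + ℝ x + ℝ y`. -/
def RealPoint.affineValues (ξ : RealPoint F) : Set ℕ :=
  {k | ∃ f ∈ Submodule.span ℝ {1, ξ.localCoord 0, ξ.localCoord 1}, f ≠ 0 ∧ ξ.HasVal f k}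

/-! ### Nonsingular points and simple tangents -/

/-- A point `p` of the curve `F = 0` is nonsingular if the gradient of `F` at `p` is nonzero. -/
def IsNonsingularAt (F : MvPolynomial (Fin 2) ℝ) (p : Fin 2 → ℝ) : Prop :=
  ∃ i, MvPolynomial.eval p (MvPolynomial.pderiv i F) ≠ 0

/-- The restriction of `F` to the tangent at a nonsingular point `p`, in terms of the parameter `z`
of the parametrization `z ↦ p + z (-F_y(p), F_x(p))` of the tangent. -/
def restrictToTangent (F : MvPolynomial (Fin 2) ℝ) (p : Fin 2 → ℝ) : Polynomial ℝ :=
  MvPolynomial.aeval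
    ![Polynomial.C (p 0) - Polynomial.C (MvPolynomial.eval p (MvPolynomial.pderiv 1 F))
        * Polynomial.X,
      Polynomial.C (p 1) + Polynomial.C (MvPolynomial.eval p (MvPolynomial.pderiv 0 F))
        * Polynomial.X] F

/-- The tangent at the nonsingular point `p` of the curve `F = 0` is simple: its contact order (the
intersection multiplicity of the tangent and the curve at `p`) equals two. If the curve is a line,
then the restriction of `F` is the zero polynomial, and the condition fails. -/
def HasSimpleTangentAt (F : MvPolynomial (Fin 2) ℝ) (p : Fin 2 → ℝ) : Prop :=
  (restrictToTangent F p).rootMultiplicity 0 = 2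

end PlaneCurve

end

noncomputable section

namespace PlaneCurve

open MvPolynomial

/-! Let `t` and `l` be affine coordinates along the tangent and the normal at η. Everything comes
from one second order Taylor formula with polynomial remainder, valid for two points in any
ℝ-algebra; simplicity of the tangent says that its `t²`-coefficient at η is nonzero.

With η as base point, the formula on `C` reads `l * w = t ^ 2 * v` with `w`, `v` nonzero at η. Hence
`t` generates the maximal ideal of the local ring of `C` at η, which is therefore integrally closed
and equals `A_ξ`. So `t` and `l` have values 1 and 2, which gives {0, 1, 2}
(`RealPoint.affineValues_eq`).

Applied to the two copies of the generic point in `A ⊗ A`, the formula expresses `Y - P * X`, with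
`X = δ(t)`, `Y = δ(l)`, `P = 1 ⊗ dl/dt`, as a quadratic form in `X`, `Y` whose `X²`-coefficient has
nonzero residue. The tensor `T` is this difference times a factor of nonzero residue
(`exists_tangentTensor_eq`). As `Y` is itself nearly a multiple of `X`, the form can be rewritten,
up to sign, as a sum of two squares with positive coefficients (`exists_sum_sq_of_quadratic`). -/

/-! ### Taylor remainder and simple tangents -/

theorem exists_taylor_rename (F : MvPolynomial (Fin 2) ℝ) :
    ∃ a b c : MvPolynomial (Fin 2 ⊕ Fin 2) ℝ,
      rename Sum.inl F - rename Sum.inr F =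
        rename Sum.inr (pderiv 0 F) * (X (Sum.inl 0) - X (Sum.inr 0)) +
        rename Sum.inr (pderiv 1 F) * (X (Sum.inl 1) - X (Sum.inr 1)) +
        (a * (X (Sum.inl 0) - X (Sum.inr 0)) ^ 2 +
          b * ((X (Sum.inl 0) - X (Sum.inr 0)) * (X (Sum.inl 1) - X (Sum.inr 1))) +
          c * (X (Sum.inl 1) - X (Sum.inr 1)) ^ 2) := by
  induction F using MvPolynomial.induction_on with
  | C r => exact ⟨0, 0, 0, by simp⟩
  | add f g hf hg =>
    obtain ⟨a, b, c, h⟩ := hf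
    obtain ⟨a', b', c', h'⟩ := hg
    refine ⟨a + a', b + b', c + c', ?_⟩
    simp only [map_add]
    linear_combination h + h'
  | mul_X f i hf =>
    obtain ⟨a, b, c, h⟩ := hf
    fin_cases i
    -- The product rule leaves the linear part of `f` multiplied by the coordinate of the first
    -- point; moving that factor to the second point adds the partial derivatives of `f` to the
    -- quadratic coefficients.
    · refine ⟨a * X (Sum.inl 0) + rename Sum.inr (pderiv 0 f),
        b * X (Sum.inl 0) + rename Sum.inr (pderiv 1 f), c * X (Sum.inl 0), ?_⟩
      simp [pderiv_X]
      linear_combination h * X (Sum.inl 0)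
    · refine ⟨a * X (Sum.inl 1), b * X (Sum.inl 1) + rename Sum.inr (pderiv 0 f),
        c * X (Sum.inl 1) + rename Sum.inr (pderiv 1 f), ?_⟩
      simp [pderiv_X]
      linear_combination h * X (Sum.inl 1)

/-- The second order Taylor formula with polynomial remainder: `a`, `b`, `c` are the coefficients
of the remainder, as polynomials in the coordinates of two points. -/
def IsTaylor (F : MvPolynomial (Fin 2) ℝ) (a b c : MvPolynomial (Fin 2 ⊕ Fin 2) ℝ) : Prop :=
  ∀ {B : Type} [CommRing B] [Algebra ℝ B] (p q : Fin 2 → B),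
    aeval p F - aeval q F =
      aeval q (pderiv 0 F) * (p 0 - q 0) + aeval q (pderiv 1 F) * (p 1 - q 1) +
      (aeval (Sum.elim p q) a * (p 0 - q 0) ^ 2 +
        aeval (Sum.elim p q) b * ((p 0 - q 0) * (p 1 - q 1)) +
        aeval (Sum.elim p q) c * (p 1 - q 1) ^ 2)

theorem exists_isTaylor (F : MvPolynomial (Fin 2) ℝ) : ∃ a b c, IsTaylor F a b c := by
  obtain ⟨a, b, c, h⟩ := exists_taylor_rename F
  refine ⟨a, b, c, fun {B} _ _ p q => ?_⟩
  have := congrArg (aeval (R := ℝ) (Sum.elim p q)) h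
  simpa [aeval_rename] using this

/-- The second order term of `F` along the tangent vector `(-F_y, F_x)`. -/
def tangentCoeff (F : MvPolynomial (Fin 2) ℝ) (p : Fin 2 → ℝ)
    (a b c : MvPolynomial (Fin 2 ⊕ Fin 2) ℝ) : ℝ :=
  aeval (Sum.elim p p) a * eval p (pderiv 1 F) ^ 2
    - aeval (Sum.elim p p) b * (eval p (pderiv 0 F) * eval p (pderiv 1 F))
    + aeval (Sum.elim p p) c * eval p (pderiv 0 F) ^ 2

/-- The zero polynomial has `rootMultiplicity` 0 by convention, not 2. -/
theorem HasSimpleTangentAt.restrict_ne_zero {F : MvPolynomial (Fin 2) ℝ} {p : Fin 2 → ℝ}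
    (h : HasSimpleTangentAt F p) : restrictToTangent F p ≠ 0 := by
  intro h0
  rw [HasSimpleTangentAt, h0] at h
  simp at h

theorem HasSimpleTangentAt.sq_dvd {F : MvPolynomial (Fin 2) ℝ} {p : Fin 2 → ℝ}
    (h : HasSimpleTangentAt F p) : (Polynomial.X : Polynomial ℝ) ^ 2 ∣ restrictToTangent F p := by
  have := Polynomial.pow_rootMultiplicity_dvd (restrictToTangent F p) 0
  rw [h] at this
  simpa using this

theorem HasSimpleTangentAt.tangentCoeff_ne_zero {F : MvPolynomial (Fin 2) ℝ} {p : Fin 2 → ℝ}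
    (h : HasSimpleTangentAt F p) (hp : aeval p F = 0)
    {a b c : MvPolynomial (Fin 2 ⊕ Fin 2) ℝ} (hT : IsTaylor F a b c) :
    tangentCoeff F p a b c ≠ 0 := by
  intro h0
  set Fx := eval p (pderiv 0 F) with hFx
  set Fy := eval p (pderiv 1 F) with hFy
  let P : Fin 2 → Polynomial ℝ := ![Polynomial.C (p 0) - Polynomial.C Fy * Polynomial.X,
      Polynomial.C (p 1) + Polynomial.C Fx * Polynomial.X]
  let Q : Fin 2 → Polynomial ℝ := fun i => Polynomial.C (p i)
  have hQ : ∀ f, aeval Q f = Polynomial.C (eval p f) := fun f => by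
    have : (Q : Fin 2 → Polynomial ℝ) = algebraMap ℝ (Polynomial ℝ) ∘ p := rfl
    rw [this, aeval_algebraMap_apply]
    rfl
  have hF0 : eval p F = 0 := hp
  have key := hT P Q
  rw [hQ, hQ, hQ, hF0, ← hFx, ← hFy] at key
  simp only [P, Q, Matrix.cons_val_zero, Matrix.cons_val_one] at key
  set a' := aeval (Sum.elim P Q) a
  set b' := aeval (Sum.elim P Q) b
  set c' := aeval (Sum.elim P Q) c
  -- Along the tangent the linear Taylor terms cancel; the bracket takes the value `tangentCoeff` at
  -- 0, so its vanishing would force contact order at least 3.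
  have hr : restrictToTangent F p = Polynomial.X ^ 2 *
      (a' * Polynomial.C Fy ^ 2 - b' * (Polynomial.C Fx * Polynomial.C Fy)
        + c' * Polynomial.C Fx ^ 2) := by
    have : restrictToTangent F p = aeval P F := rfl
    rw [this]
    rw [Polynomial.C_0] at key
    linear_combination key
  have hev : ∀ f : MvPolynomial (Fin 2 ⊕ Fin 2) ℝ,
      (aeval (Sum.elim P Q) f).eval 0 = aeval (Sum.elim p p) f := fun f => by
    rw [← Polynomial.coe_aeval_eq_eval, ← AlgHom.comp_apply]
    congr 1
    apply MvPolynomial.algHom_ext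
    rintro (i | i)
    · fin_cases i <;> simp [P]
    · simp [Q]
  have hX : (Polynomial.X : Polynomial ℝ) ∣ (a' * Polynomial.C Fy ^ 2
      - b' * (Polynomial.C Fx * Polynomial.C Fy) + c' * Polynomial.C Fx ^ 2) := by
    rw [Polynomial.X_dvd_iff, Polynomial.coeff_zero_eq_eval_zero]
    simp only [Polynomial.eval_add, Polynomial.eval_sub, Polynomial.eval_mul, Polynomial.eval_pow,
      Polynomial.eval_C, a', b', c', hev]
    exact h0
  have hdvd : (Polynomial.X : Polynomial ℝ) ^ 3 ∣ restrictToTangent F p := by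
    rw [hr, pow_succ]
    exact mul_dvd_mul_left _ hX
  have h3 : 3 ≤ (restrictToTangent F p).rootMultiplicity 0 := by
    rw [Polynomial.le_rootMultiplicity_iff h.restrict_ne_zero]
    simpa using hdvd
  rw [h] at h3
  omega

theorem derivation_aeval {A M : Type*} [CommRing A] [Algebra ℝ A] [AddCommGroup M] [Module A M]
    [Module ℝ M] (D : Derivation ℝ A M) (x : Fin 2 → A) (F : MvPolynomial (Fin 2) ℝ) :
    D (aeval x F) = aeval x (pderiv 0 F) • D (x 0) + aeval x (pderiv 1 F) • D (x 1) := by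
  induction F using MvPolynomial.induction_on with
  | C r => simp
  | add f g hf hg => simp only [map_add, hf, hg, add_smul]; abel
  | mul_X f i hf =>
    fin_cases i
    · simp [pderiv_X, hf, add_smul, mul_smul]
      module
    · simp [pderiv_X, hf, add_smul, mul_smul]
      module

theorem sub_C_eval_mem_span (p : Fin 2 → ℝ) (f : MvPolynomial (Fin 2) ℝ) :
    f - C (eval p f) ∈
      Ideal.span {(X 0 - C (p 0) : MvPolynomial (Fin 2) ℝ), X 1 - C (p 1)} := by
  induction f using MvPolynomial.induction_on with
  | C r => simp
  | add f g hf hg =>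
    have := add_mem hf hg
    simp only [map_add]
    convert this using 1
    ring
  | mul_X f i hf =>
    have hi : (X i - C (p i) : MvPolynomial (Fin 2) ℝ) ∈
        Ideal.span {(X 0 - C (p 0) : MvPolynomial (Fin 2) ℝ), X 1 - C (p 1)} := by
      fin_cases i <;> exact Ideal.subset_span (by simp)
    have := add_mem (Ideal.mul_mem_left _ (X i) hf) (Ideal.mul_mem_left _ (C (eval p f)) hi)
    simp only [map_mul, eval_X]
    convert this using 1
    ring

/-- If the localization at `P` of a noetherian domain `R` has a principal maximal ideal, then it
contains every element of the field of fractions that is integral over `R`. -/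
theorem exists_mul_eq_of_isIntegral {R K : Type*} [CommRing R] [IsDomain R] [IsNoetherianRing R]
    [Field K] [Algebra R K] [IsFractionRing R K] (P : Ideal R) [P.IsPrime] {t : R} (ht : t ∈ P)
    (h : ∀ r ∈ P, ∃ q ∉ P, t ∣ q * r) {x : K} (hx : IsIntegral R x) :
    ∃ q r : R, q ∉ P ∧ algebraMap R K q * x = algebraMap R K r := by
  have hle : P.primeCompl ≤ nonZeroDivisors R := P.primeCompl_le_nonZeroDivisors
  let O := Localization.subalgebra K P.primeCompl hle
  have hloc : IsLocalization.AtPrime O P :=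
    inferInstanceAs (IsLocalization P.primeCompl (Localization.subalgebra K P.primeCompl hle))
  have hfrac : IsFractionRing O K :=
    inferInstanceAs (IsFractionRing (Localization.subalgebra K P.primeCompl hle) K)
  have : IsLocalRing O := IsLocalization.AtPrime.isLocalRing O P
  have : IsNoetherianRing O := IsLocalization.isNoetherianRing P.primeCompl O inferInstance
  have hmax : IsLocalRing.maximalIdeal O = Ideal.span {algebraMap R O t} := by
    rw [← IsLocalization.AtPrime.map_eq_maximalIdeal P O]
    apply le_antisymm
    · rw [Ideal.map_le_iff_le_comap]
      intro r hr
      obtain ⟨q, hq, d, hd⟩ := h r hr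
      have hu : IsUnit (algebraMap R O q) :=
        IsLocalization.map_units (M := P.primeCompl) O ⟨q, hq⟩
      rw [Ideal.mem_comap, Ideal.mem_span_singleton, ← hu.dvd_mul_left, ← map_mul, hd, map_mul]
      exact dvd_mul_right _ _
    · rw [Ideal.span_singleton_le_iff_mem]
      exact Ideal.mem_map_of_mem _ ht
  have hprin : (IsLocalRing.maximalIdeal O).IsPrincipal := ⟨⟨_, hmax⟩⟩
  have hint : IsIntegrallyClosed O := by
    -- A noetherian local domain with principal maximal ideal is a discrete valuation ring or a
    -- field, hence integrally closed.
    have h43 := (tfae_of_isNoetherianRing_of_isLocalRing_of_isDomain O).out 4 3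
    exact (h43.mp hprin).1
  have hxO : IsIntegral O x := hx.tower_top
  obtain ⟨y, rfl⟩ := (IsIntegrallyClosed.isIntegral_iff (R := O)).mp hxO
  obtain ⟨⟨r, q⟩, hrq⟩ := IsLocalization.surj P.primeCompl y
  refine ⟨q, r, q.2, ?_⟩
  have := congrArg (algebraMap O K) hrq
  rw [map_mul, ← IsScalarTower.algebraMap_apply, ← IsScalarTower.algebraMap_apply] at this
  rw [mul_comm]
  exact this

/-! ### Derivatives, tensors and sums of two squares -/

section Tensor

variable {A : Type*} [CommRing A] [Algebra ℝ A]

theorem delta_add (f g : A) : delta (f + g) = delta f + delta g := by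
  simp only [delta, TensorProduct.add_tmul, TensorProduct.tmul_add]
  abel

theorem delta_smul (r : ℝ) (f : A) : delta (r • f) = r • delta f := by
  simp only [delta, TensorProduct.tmul_smul, TensorProduct.smul_tmul', smul_sub]

theorem delta_algebraMap (r : ℝ) : delta (algebraMap ℝ A r) = 0 := by
  simp [delta, Algebra.algebraMap_eq_smul_one, TensorProduct.smul_tmul]

theorem derivWrt_eq {s : A} (hs : IsFreeGenerator s) {f c : A}
    (h : KaehlerDifferential.D ℝ A f = c • KaehlerDifferential.D ℝ A s) : derivWrt hs f = c :=
  ((hs _).choose_spec.2 c h).symm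

theorem IsFreeGenerator.eq_zero {s : A} (hs : IsFreeGenerator s) {c : A}
    (h : c • KaehlerDifferential.D ℝ A s = 0) : c = 0 :=
  (hs 0).unique h.symm (zero_smul _ _).symm

theorem derivWrt_add {s : A} (hs : IsFreeGenerator s) (f g : A) :
    derivWrt hs (f + g) = derivWrt hs f + derivWrt hs g :=
  derivWrt_eq hs (by rw [map_add, add_smul, ← derivWrt_spec, ← derivWrt_spec])

theorem derivWrt_smul {s : A} (hs : IsFreeGenerator s) (r : ℝ) (f : A) :
    derivWrt hs (r • f) = r • derivWrt hs f :=
  derivWrt_eq hs (by rw [Derivation.map_smul, smul_assoc, ← derivWrt_spec])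

theorem derivWrt_algebraMap {s : A} (hs : IsFreeGenerator s) (r : ℝ) :
    derivWrt hs (algebraMap ℝ A r) = 0 :=
  derivWrt_eq hs (by simp)

/-- The derivation `f ↦ f - f(ξ)` with values in `A ⧸ m ^ 2`, where `m` is the kernel of the
evaluation `ε` at `ξ`. -/
def cotangentDerivation (ε : A →ₐ[ℝ] ℝ) : Derivation ℝ A (A ⧸ RingHom.ker ε ^ 2) :=
  Derivation.mk'
    ((Ideal.Quotient.mkₐ ℝ (RingHom.ker ε ^ 2)).toLinearMap ∘ₗ
      (LinearMap.id - (Algebra.linearMap ℝ A) ∘ₗ ε.toLinearMap)) (by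
    intro f g
    have hm : ∀ f : A, f - algebraMap ℝ A (ε f) ∈ RingHom.ker ε := fun f => by
      simp [RingHom.mem_ker]
    -- The defect in the Leibniz rule is `-(f - f(ξ)) * (g - g(ξ))`, which lies in `m ^ 2`.
    have := Ideal.mul_mem_mul (hm f) (hm g)
    rw [← pow_two] at this
    simp only [LinearMap.comp_apply, LinearMap.sub_apply, LinearMap.id_apply,
      AlgHom.toLinearMap_apply, Algebra.linearMap_apply, Ideal.Quotient.mkₐ_eq_mk, map_mul]
    rw [← sub_eq_zero]
    simp only [Algebra.smul_def, Ideal.Quotient.algebraMap_eq, ← map_mul, ← map_add, ← map_sub]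
    rw [Ideal.Quotient.eq_zero_iff_mem, ← neg_mem_iff]
    convert this using 1
    rw [map_mul, map_mul]
    ring)

theorem cotangentDerivation_apply (ε : A →ₐ[ℝ] ℝ) (f : A) :
    cotangentDerivation ε f =
      Ideal.Quotient.mk (RingHom.ker ε ^ 2) (f - algebraMap ℝ A (ε f)) := rfl

/-- The derivation into `A ⧸ m ^ 2` turns `dt = (dt/ds) ds` into `t ≡ (dt/ds) * (s - s(ξ))`; if
`dt/ds` vanished at ξ, both factors would lie in `m`. -/
theorem eval_derivWrt_ne_zero (ε : A →ₐ[ℝ] ℝ) {s : A} (hs : IsFreeGenerator s) {t : A}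
    (ht : ε t = 0) (ht2 : t ∉ RingHom.ker ε ^ 2) : ε (derivWrt hs t) ≠ 0 := by
  intro h
  apply ht2
  have h1 := congrArg (cotangentDerivation ε).liftKaehlerDifferential (derivWrt_spec hs t)
  rw [map_smul, Derivation.liftKaehlerDifferential_comp_D,
    Derivation.liftKaehlerDifferential_comp_D, cotangentDerivation_apply,
    cotangentDerivation_apply, Algebra.smul_def, Ideal.Quotient.algebraMap_eq, ← map_mul,
    ht, map_zero, sub_zero] at h1
  rw [← Ideal.Quotient.eq_zero_iff_mem, h1, Ideal.Quotient.eq_zero_iff_mem, pow_two]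
  exact Ideal.mul_mem_mul h (by simp [RingHom.mem_ker])

/-- Multiplying `hY` by `X` turns the mixed term into a combination of `X²` and `Y²` without
changing the residue `ρ κ * ρ a` of the `X²`-coefficient, which decides the sign. The residue of the
`Y²`-coefficient is then made positive by adding a multiple of a relation between `X²` and `Y²` that
is invisible in the residue of the other coefficient. -/
theorem exists_sum_sq_of_quadratic {B : Type*} [CommRing B] [Algebra ℝ B] (ρ : B →ₐ[ℝ] ℝ)
    {X Y P a b c κ : B} (hY : Y = P * X + (a * X ^ 2 + b * (X * Y) + c * Y ^ 2))
    (hρX : ρ X = 0) (hρY : ρ Y = 0) (hρP : ρ P = 0) (ha : ρ a ≠ 0) (hκ : ρ κ ≠ 0) :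
    ∃ α β : B,
      (κ * (a * X ^ 2 + b * (X * Y) + c * Y ^ 2) = α * X ^ 2 + β * Y ^ 2 ∨
        -(κ * (a * X ^ 2 + b * (X * Y) + c * Y ^ 2)) = α * X ^ 2 + β * Y ^ 2) ∧
      0 < ρ α ∧ 0 < ρ β := by
  have hXY : X * Y = (P + a * X + b * Y) * X ^ 2 + c * X * Y ^ 2 := by
    linear_combination X * hY
  have hrel : (1 - b * X - c * Y) * Y = (P + a * X) * X := by linear_combination hY
  -- The left coefficient has residue 0, the right one residue 1.
  have hsq : (P + a * X) ^ 2 * X ^ 2 = (1 - b * X - c * Y) ^ 2 * Y ^ 2 := by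
    rw [← mul_pow, ← mul_pow, hrel]
  set α₀ : B := κ * (a + b * (P + a * X + b * Y)) with hα₀
  set β₀ : B := κ * (c + b * (c * X)) with hβ₀
  have hT : κ * (a * X ^ 2 + b * (X * Y) + c * Y ^ 2) = α₀ * X ^ 2 + β₀ * Y ^ 2 := by
    rw [hα₀, hβ₀]
    linear_combination κ * b * hXY
  have hα₀ρ : ρ α₀ = ρ κ * ρ a := by simp [hα₀, hρX, hρY, hρP]
  -- Large enough to make the coefficient of `Y²` positive for either sign.
  let lam : B := algebraMap ℝ B (1 + |ρ β₀|)
  have hlam : ρ lam = 1 + |ρ β₀| := by simp [lam]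
  rcases lt_or_gt_of_ne (mul_ne_zero hκ ha) with hneg | hpos
  · refine ⟨-α₀ - lam * (P + a * X) ^ 2, -β₀ + lam * (1 - b * X - c * Y) ^ 2, Or.inr ?_, ?_, ?_⟩
    · rw [hT]
      linear_combination lam * hsq
    · simp [hα₀ρ, hρX, hρP, hneg]
    · simp only [map_add, map_neg, map_mul, map_pow, map_sub, map_one, hρX, hρY, hlam]
      linarith [le_abs_self (ρ β₀)]
  · refine ⟨α₀ - lam * (P + a * X) ^ 2, β₀ + lam * (1 - b * X - c * Y) ^ 2, Or.inl ?_, ?_, ?_⟩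
    · rw [hT]
      linear_combination lam * hsq
    · simp [hα₀ρ, hρX, hρP, hpos]
    · simp only [map_add, map_mul, map_pow, map_sub, map_one, hρX, hρY, hlam]
      linarith [neg_abs_le (ρ β₀)]

end Tensor

/-- In the coordinates `t`, `l` the tensor is a multiple of `δ(l) - (1 ⊗ dl/dt) * δ(t)`, which is
exactly what the Taylor formula on `A ⊗ A` computes up to second order, since `F` vanishes at both
copies of the generic point. -/
theorem exists_tangentTensor_eq {A : Type} [CommRing A] [Algebra ℝ A] (ε : A →ₐ[ℝ] ℝ)
    (hε : ∀ f, ε f ≠ 0 → IsUnit f) {F : MvPolynomial (Fin 2) ℝ} {x : Fin 2 → A} {p : Fin 2 → ℝ}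
    (hF : aeval x F = 0) (hp : ∀ i, ε (x i) = p i)
    {a b c : MvPolynomial (Fin 2 ⊕ Fin 2) ℝ} (hT : IsTaylor F a b c)
    (hcoeff : tangentCoeff F p a b c ≠ 0)
    (hN : eval p (pderiv 0 F) ^ 2 + eval p (pderiv 1 F) ^ 2 ≠ 0) {t l : A}
    (hx0 : x 0 = algebraMap ℝ A (p 0) + (-eval p (pderiv 1 F)) • t + eval p (pderiv 0 F) • l)
    (hx1 : x 1 = algebraMap ℝ A (p 1) + eval p (pderiv 0 F) • t + eval p (pderiv 1 F) • l)
    {s : A} (hs : IsFreeGenerator s) (hts : ε (derivWrt hs t) ≠ 0) :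
    ∃ (u₁ u₂ : A) (α β : A ⊗[ℝ] A),
      (tangentTensor hs (x 0) (x 1) = α * delta u₁ ^ 2 + β * delta u₂ ^ 2 ∨
        -tangentTensor hs (x 0) (x 1) = α * delta u₁ ^ 2 + β * delta u₂ ^ 2) ∧
      0 < ε.comp (Algebra.TensorProduct.lmul' ℝ) α ∧
      0 < ε.comp (Algebra.TensorProduct.lmul' ℝ) β := by
  set ρ : A ⊗[ℝ] A →ₐ[ℝ] ℝ := ε.comp (Algebra.TensorProduct.lmul' ℝ) with hρdef
  set Fx := eval p (pderiv 0 F) with hFx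
  set Fy := eval p (pderiv 1 F) with hFy
  have hρl : ∀ f : A, ρ (f ⊗ₜ 1) = ε f := fun f => by simp [hρdef]
  have hρr : ∀ f : A, ρ (1 ⊗ₜ f) = ε f := fun f => by simp [hρdef]
  have hρδ : ∀ f : A, ρ (delta f) = 0 := fun f => by rw [delta, map_sub, hρl, hρr, sub_self]
  have hεF : ∀ f, ε (aeval x f) = eval p f := fun f => by
    rw [comp_aeval_apply, funext hp]
    rfl
  let j : A →ₐ[ℝ] A ⊗[ℝ] A := Algebra.TensorProduct.includeRight
  let i : A →ₐ[ℝ] A ⊗[ℝ] A := Algebra.TensorProduct.includeLeft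
  have hδ0 : i (x 0) - j (x 0) = -algebraMap ℝ _ Fy * delta t + algebraMap ℝ _ Fx * delta l := by
    change delta (x 0) = _
    rw [hx0, delta_add, delta_add, delta_algebraMap, delta_smul, delta_smul, Algebra.smul_def,
      Algebra.smul_def, map_neg, zero_add]
  have hδ1 : i (x 1) - j (x 1) = algebraMap ℝ _ Fx * delta t + algebraMap ℝ _ Fy * delta l := by
    change delta (x 1) = _
    rw [hx1, delta_add, delta_add, delta_algebraMap, delta_smul, delta_smul, Algebra.smul_def,
      Algebra.smul_def, zero_add]
  have hd0 : derivWrt hs (x 0) =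
      -algebraMap ℝ A Fy * derivWrt hs t + algebraMap ℝ A Fx * derivWrt hs l := by
    rw [hx0, derivWrt_add, derivWrt_add, derivWrt_algebraMap, derivWrt_smul, derivWrt_smul,
      Algebra.smul_def, Algebra.smul_def, map_neg, zero_add]
  have hd1 : derivWrt hs (x 1) =
      algebraMap ℝ A Fx * derivWrt hs t + algebraMap ℝ A Fy * derivWrt hs l := by
    rw [hx1, derivWrt_add, derivWrt_add, derivWrt_algebraMap, derivWrt_smul, derivWrt_smul,
      Algebra.smul_def, Algebra.smul_def, zero_add]
  set G0 := aeval x (pderiv 0 F) with hG0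
  set G1 := aeval x (pderiv 1 F) with hG1
  have hεG0 : ε G0 = Fx := hεF _
  have hεG1 : ε G1 = Fy := hεF _
  have hj : ∀ r : ℝ, j (algebraMap ℝ A r) = algebraMap ℝ _ r := j.commutes
  -- the tangential derivatives
  have hds : G0 * derivWrt hs (x 0) + G1 * derivWrt hs (x 1) = 0 := by
    apply hs.eq_zero
    have := derivation_aeval (KaehlerDifferential.D ℝ A) x F
    rw [hF, map_zero, derivWrt_spec hs (x 0), derivWrt_spec hs (x 1), smul_smul, smul_smul,
      ← add_smul] at this
    exact this.symm
  -- This is the derivative of `F` in the direction of `l`; its value at ξ is the squared norm of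
  -- the gradient, so it is a unit.
  obtain ⟨u, hu⟩ := (hε (algebraMap ℝ A Fx * G0 + algebraMap ℝ A Fy * G1) (by
    simp only [map_add, map_mul, hεG0, hεG1, AlgHom.commutes, Algebra.algebraMap_self,
      RingHom.id_apply]
    convert hN using 1
    ring)).exists_right_inv
  have hεu : ε u ≠ 0 := fun h => by
    have := congrArg ε hu
    rw [map_mul, h, mul_zero, map_one] at this
    exact zero_ne_one this
  -- `P` is `dl/dt`, by implicit differentiation of `F = 0`.
  set P : A := -(u * (-algebraMap ℝ A Fy * G0 + algebraMap ℝ A Fx * G1)) with hP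
  have hεP : ε P = 0 := by
    simp only [hP, map_neg, map_add, map_mul, hεG0, hεG1, AlgHom.commutes,
      Algebra.algebraMap_self, RingHom.id_apply]
    ring
  have hl : derivWrt hs l = P * derivWrt hs t := by
    rw [hd0, hd1] at hds
    rw [hP]
    linear_combination u * hds - derivWrt hs l * hu
  -- Taylor expansion along the diagonal
  have key := hT (fun k => i (x k)) (fun k => j (x k))
  have hi' : aeval (fun k => i (x k)) F = 0 := by
    rw [← comp_aeval_apply, hF, map_zero]
  have hj' : ∀ f, aeval (fun k => j (x k)) f = j (aeval x f) := fun f =>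
    (comp_aeval_apply x j f).symm
  have hρaeval : ∀ f, ρ (aeval (Sum.elim (fun k => i (x k)) (fun k => j (x k))) f) =
      aeval (Sum.elim p p) f := fun f => by
    rw [comp_aeval_apply]
    congr 2
    ext (k | k)
    · exact (hρl _).trans (hp k)
    · exact (hρr _).trans (hp k)
  rw [hi', hj', hj', hj', hF, map_zero, sub_zero, hδ0, hδ1, ← hG0, ← hG1] at key
  have hρa := hρaeval a
  have hρb := hρaeval b
  have hρc := hρaeval c
  set a' := aeval (Sum.elim (fun k => i (x k)) (fun k => j (x k))) a
  set b' := aeval (Sum.elim (fun k => i (x k)) (fun k => j (x k))) b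
  set c' := aeval (Sum.elim (fun k => i (x k)) (fun k => j (x k))) c
  set X := delta t with hX
  set Y := delta l with hYdef
  set fx := algebraMap ℝ (A ⊗[ℝ] A) Fx with hfx
  set fy := algebraMap ℝ (A ⊗[ℝ] A) Fy with hfy
  have hju : (fx * j G0 + fy * j G1) * j u = 1 := by
    have := congrArg j hu
    simpa only [map_mul, map_add, hj, map_one] using this
  have hjP : j P = -(j u * (-fy * j G0 + fx * j G1)) := by
    rw [hP]
    simp only [map_neg, map_mul, map_add, hj]
    rfl
  -- The Taylor identity solved for the linear occurrence of `Y`, using the inverse `j u`.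
  have hY : Y = j P * X + ((-j u * (a' * fy ^ 2 - b' * (fx * fy) + c' * fx ^ 2)) * X ^ 2 +
      (-j u * (-2 * a' * (fx * fy) + b' * (fx ^ 2 - fy ^ 2) + 2 * c' * (fx * fy))) * (X * Y) +
      (-j u * (a' * fx ^ 2 + b' * (fx * fy) + c' * fy ^ 2)) * Y ^ 2) := by
    rw [hjP]
    linear_combination -Y * hju - j u * key
  have hρfx : ρ fx = Fx := ρ.commutes Fx
  have hρfy : ρ fy = Fy := ρ.commutes Fy
  obtain ⟨α, β, h, hα, hβ⟩ := exists_sum_sq_of_quadratic ρ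
    (κ := -(fx ^ 2 + fy ^ 2) * j (derivWrt hs t)) hY (hρδ t) (hρδ l)
    ((hρr P).trans hεP)
    (by
      simp only [map_neg, map_mul, map_add, map_sub, map_pow, hρa, hρb, hρc, hρfx, hρfy]
      exact mul_ne_zero (neg_ne_zero.mpr (by rw [show ρ (j u) = ε u from hρr u]; exact hεu))
        hcoeff)
    (by
      simp only [map_neg, map_mul, map_add, map_pow, hρfx, hρfy]
      rw [show ρ (j (derivWrt hs t)) = _ from hρr _]
      exact mul_ne_zero (neg_ne_zero.mpr hN) hts)
  refine ⟨t, l, α, β, ?_, hα, hβ⟩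
  have hTT : tangentTensor hs (x 0) (x 1) = -(fx ^ 2 + fy ^ 2) * j (derivWrt hs t) *
      (Y - j P * X) := by
    have hd0' : j (derivWrt hs (x 0)) =
        -fy * j (derivWrt hs t) + fx * (j P * j (derivWrt hs t)) := by
      rw [hd0, hl]; simp only [map_neg, map_mul, map_add, hj]; rfl
    have hd1' : j (derivWrt hs (x 1)) =
        fx * j (derivWrt hs t) + fy * (j P * j (derivWrt hs t)) := by
      rw [hd1, hl]; simp only [map_mul, map_add, hj]; rfl
    change j (derivWrt hs (x 0)) * (i (x 1) - j (x 1)) -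
      j (derivWrt hs (x 1)) * (i (x 0) - j (x 0)) = _
    rw [hδ0, hδ1, hd0', hd1']
    ring
  rw [hTT, show Y - j P * X = _ from sub_eq_iff_eq_add'.mpr hY]
  exact h

/-! ### Affine coordinates along the tangent and the normal -/

section Parameters

variable (F : MvPolynomial (Fin 2) ℝ) (p : Fin 2 → ℝ)

/-- The squared norm of the gradient. -/
def gradSq : ℝ := eval p (pderiv 0 F) ^ 2 + eval p (pderiv 1 F) ^ 2

/-- The affine coordinate along the tangent at `p`. -/
def tangentParam : MvPolynomial (Fin 2) ℝ :=
  C (gradSq F p)⁻¹ * (-C (eval p (pderiv 1 F)) * (X 0 - C (p 0)) +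
    C (eval p (pderiv 0 F)) * (X 1 - C (p 1)))

/-- The affine coordinate along the normal at `p`. -/
def normalParam : MvPolynomial (Fin 2) ℝ :=
  C (gradSq F p)⁻¹ * (C (eval p (pderiv 0 F)) * (X 0 - C (p 0)) +
    C (eval p (pderiv 1 F)) * (X 1 - C (p 1)))

variable {F p}

theorem IsNonsingularAt.gradSq_ne_zero (h : IsNonsingularAt F p) : gradSq F p ≠ 0 := by
  obtain ⟨i, hi⟩ := h
  have h0 := sq_nonneg (eval p (pderiv 0 F))
  have h1 := sq_nonneg (eval p (pderiv 1 F))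
  have h2 := sq_pos_of_ne_zero hi
  rw [gradSq]
  fin_cases i <;> simp only [Fin.zero_eta, Fin.mk_one] at h2 <;> linarith

theorem C_gradSq_mul_inv (h : gradSq F p ≠ 0) :
    (C (eval p (pderiv 0 F)) ^ 2 + C (eval p (pderiv 1 F)) ^ 2) * C (gradSq F p)⁻¹ =
      (1 : MvPolynomial (Fin 2) ℝ) := by
  rw [← C_pow, ← C_pow, ← C_add, ← C_mul, ← C_1]
  exact congrArg C (mul_inv_cancel₀ h)

theorem X_zero_eq (h : gradSq F p ≠ 0) : (X 0 : MvPolynomial (Fin 2) ℝ) =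
    C (p 0) + (-eval p (pderiv 1 F)) • tangentParam F p +
      eval p (pderiv 0 F) • normalParam F p := by
  rw [tangentParam, normalParam, smul_eq_C_mul, smul_eq_C_mul, C_neg]
  linear_combination (-(X 0 - C (p 0))) * C_gradSq_mul_inv h

theorem X_one_eq (h : gradSq F p ≠ 0) : (X 1 : MvPolynomial (Fin 2) ℝ) =
    C (p 1) + eval p (pderiv 0 F) • tangentParam F p +
      eval p (pderiv 1 F) • normalParam F p := by
  rw [tangentParam, normalParam, smul_eq_C_mul, smul_eq_C_mul]
  linear_combination (-(X 1 - C (p 1))) * C_gradSq_mul_inv h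

theorem eval_tangentParam : eval p (tangentParam F p) = 0 := by simp [tangentParam]

theorem eval_normalParam : eval p (normalParam F p) = 0 := by simp [normalParam]

theorem exists_eq_tangentParam_add_normalParam (h : gradSq F p ≠ 0)
    {f : MvPolynomial (Fin 2) ℝ} (hf : eval p f = 0) :
    ∃ g k, f = g * tangentParam F p + k * normalParam F p := by
  have hmem := sub_C_eval_mem_span p f
  rw [hf, C_0, sub_zero, Ideal.mem_span_pair] at hmem
  obtain ⟨g, k, hgk⟩ := hmem
  have h0 := X_zero_eq h
  have h1 := X_one_eq h
  rw [smul_eq_C_mul, smul_eq_C_mul] at h0 h1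
  refine ⟨g * C (-eval p (pderiv 1 F)) + k * C (eval p (pderiv 0 F)),
    g * C (eval p (pderiv 0 F)) + k * C (eval p (pderiv 1 F)), ?_⟩
  linear_combination -hgk + g * h0 + k * h1

/-- On the tangent line `tangentParam` restricts to the parameter itself, whereas `F` restricts to a
multiple of its square. -/
theorem HasSimpleTangentAt.not_dvd_tangentParam (h : HasSimpleTangentAt F p)
    (hN : gradSq F p ≠ 0) : ¬ F ∣ tangentParam F p := by
  intro hdvd
  let P : Fin 2 → Polynomial ℝ :=
    ![Polynomial.C (p 0) - Polynomial.C (eval p (pderiv 1 F)) * Polynomial.X,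
      Polynomial.C (p 1) + Polynomial.C (eval p (pderiv 0 F)) * Polynomial.X]
  have h1 : restrictToTangent F p ∣ aeval P (tangentParam F p) := map_dvd (aeval P) hdvd
  have h2 : aeval P (tangentParam F p) = Polynomial.X := by
    have hc : (Polynomial.C (eval p (pderiv 0 F)) ^ 2 + Polynomial.C (eval p (pderiv 1 F)) ^ 2) *
        Polynomial.C (gradSq F p)⁻¹ = (1 : Polynomial ℝ) := by
      rw [← Polynomial.C_pow, ← Polynomial.C_pow, ← Polynomial.C_add, ← Polynomial.C_mul,
        ← Polynomial.C_1]
      exact congrArg Polynomial.C (mul_inv_cancel₀ hN)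
    simp only [tangentParam, map_mul, map_add, map_sub, map_neg, aeval_X, algHom_C,
      Polynomial.algebraMap_eq, P, Matrix.cons_val_zero, Matrix.cons_val_one]
    linear_combination Polynomial.X * hc
  have h3 := h.sq_dvd.trans h1
  rw [h2] at h3
  have h4 := Polynomial.natDegree_le_of_dvd h3 Polynomial.X_ne_zero
  simp at h4

/-- Taylor formula based at the constant point `p`: the linear part is `gradSq` times the normal
coordinate. Terms containing that coordinate go into `w`, the rest into `v`, with values `gradSq`
and `-tangentCoeff`. The algebra `B` is general because both `ℝ[C]` and the local ring at ξ are
needed. -/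
theorem exists_normalParam_mul_eq {B : Type} [CommRing B] [Algebra ℝ B]
    (φ : MvPolynomial (Fin 2) ℝ →ₐ[ℝ] B) (ε : B →ₐ[ℝ] ℝ) (hF : φ F = 0)
    (hφ : ∀ f, ε (φ f) = eval p f) (hN : gradSq F p ≠ 0)
    (htan : HasSimpleTangentAt F p) :
    ∃ w v : B, φ (normalParam F p) * w = φ (tangentParam F p) ^ 2 * v ∧ ε w ≠ 0 ∧ ε v ≠ 0 := by
  obtain ⟨a, b, c, hT⟩ := exists_isTaylor F
  have hpF : eval p F = 0 := by rw [← hφ, hF, map_zero]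
  have hcoeff := htan.tangentCoeff_ne_zero hpF hT
  have hBp : ∀ f, aeval (fun i => algebraMap ℝ B (p i)) f = algebraMap ℝ B (eval p f) := fun f =>
    aeval_algebraMap_apply B p f
  have hBx : ∀ f, aeval (fun i => φ (X i)) f = φ f := fun f => by
    rw [← comp_aeval_apply, aeval_X_left_apply]
  have key := hT (fun i => φ (X i)) (fun i => algebraMap ℝ B (p i))
  rw [hBx, hF, hBp, hBp, hBp, hpF] at key
  have hρ : ∀ f, ε (aeval (Sum.elim (fun i => φ (X i)) fun i => algebraMap ℝ B (p i)) f) =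
      aeval (Sum.elim p p) f := fun f => by
    rw [comp_aeval_apply]
    congr 2
    ext (k | k)
    · simp [hφ]
    · simp
  have ha := hρ a
  have hb := hρ b
  have hc := hρ c
  have h0 := congrArg φ (X_zero_eq hN)
  have h1 := congrArg φ (X_one_eq hN)
  simp only [map_add, map_smul, algHom_C] at h0 h1
  simp only [Algebra.smul_def, map_neg] at h0 h1
  set a' := aeval (Sum.elim (fun i => φ (X i)) fun i => algebraMap ℝ B (p i)) a
  set b' := aeval (Sum.elim (fun i => φ (X i)) fun i => algebraMap ℝ B (p i)) b
  set c' := aeval (Sum.elim (fun i => φ (X i)) fun i => algebraMap ℝ B (p i)) c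
  set fx := algebraMap ℝ B (eval p (pderiv 0 F)) with hfx
  set fy := algebraMap ℝ B (eval p (pderiv 1 F)) with hfy
  rw [h0, h1, map_zero] at key
  have hεfx : ε fx = eval p (pderiv 0 F) := ε.commutes _
  have hεfy : ε fy = eval p (pderiv 1 F) := ε.commutes _
  refine ⟨fx ^ 2 + fy ^ 2 +
      (-2 * a' * (fx * fy) + b' * (fx ^ 2 - fy ^ 2) + 2 * c' * (fx * fy)) *
        φ (tangentParam F p) +
      (a' * fx ^ 2 + b' * (fx * fy) + c' * fy ^ 2) * φ (normalParam F p),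
    -(a' * fy ^ 2 - b' * (fx * fy) + c' * fx ^ 2), ?_, ?_, ?_⟩
  · linear_combination -key
  · simp only [map_add, map_mul, map_pow, hφ, eval_tangentParam, eval_normalParam, hεfx, hεfy,
      mul_zero, add_zero]
    exact hN
  · simp only [map_neg, map_sub, map_add, map_mul, map_pow, ha, hb, hc, hεfx, hεfy]
    exact neg_ne_zero.mpr hcoeff

end Parameters

/-! ### The local ring at ξ and its valuation -/

section LocalRing

variable {F : MvPolynomial (Fin 2) ℝ}

theorem CoordRing.mk_surjective : Function.Surjective (CoordRing.mk F) :=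
  Ideal.Quotient.mk_surjective

theorem CoordRing.mk_eq_zero {f : MvPolynomial (Fin 2) ℝ} : CoordRing.mk F f = 0 ↔ F ∣ f :=
  Ideal.Quotient.eq_zero_iff_mem.trans Ideal.mem_span_singleton

theorem CoordRing.isDomain (hF : Irreducible F) : IsDomain (CoordRing F) := by
  have : (Ideal.span {F}).IsPrime := (Ideal.span_singleton_prime hF.ne_zero).mpr hF.prime
  exact inferInstanceAs (IsDomain (MvPolynomial (Fin 2) ℝ ⧸ Ideal.span {F}))

instance CoordRing.isNoetherianRing : IsNoetherianRing (CoordRing F) :=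
  inferInstanceAs (IsNoetherianRing (MvPolynomial (Fin 2) ℝ ⧸ Ideal.span {F}))

theorem NormRing.isDomain (hF : Irreducible F) : IsDomain (NormRing F) := by
  have := CoordRing.isDomain hF
  exact inferInstanceAs
    (IsDomain (integralClosure (CoordRing F) (FractionRing (CoordRing F))))

theorem NormRing.algebraMap_injective :
    Function.Injective (algebraMap (CoordRing F) (NormRing F)) := fun _ _ h =>
  IsFractionRing.injective (CoordRing F) (FractionRing (CoordRing F)) (congrArg Subtype.val h)

variable (ξ : RealPoint F)

theorem RealPoint.isDomain_localRing (hF : Irreducible F) : IsDomain ξ.LocalRing := by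
  have := NormRing.isDomain hF
  exact IsLocalization.isDomain_of_le_nonZeroDivisors ξ.LocalRing
    (RingHom.ker ξ).primeCompl_le_nonZeroDivisors

theorem RealPoint.eval_algebraMap (g : NormRing F) :
    ξ.eval (algebraMap (NormRing F) ξ.LocalRing g) = ξ g := by
  rw [RealPoint.eval, IsLocalization.liftAlgHom_apply]
  exact IsLocalization.lift_eq _ _

theorem RealPoint.isUnit_algebraMap {g : NormRing F} (hg : ξ g ≠ 0) :
    IsUnit (algebraMap (NormRing F) ξ.LocalRing g) :=
  IsLocalization.map_units (M := (RingHom.ker ξ).primeCompl) ξ.LocalRing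
    ⟨g, fun h => hg (RingHom.mem_ker.mp h)⟩

theorem RealPoint.exists_mul_eq_algebraMap (f : ξ.LocalRing) :
    ∃ q g : NormRing F, ξ q ≠ 0 ∧
      f * algebraMap (NormRing F) ξ.LocalRing q = algebraMap (NormRing F) ξ.LocalRing g := by
  obtain ⟨⟨g, q⟩, h⟩ := IsLocalization.surj (RingHom.ker ξ).primeCompl f
  exact ⟨q, g, fun h => q.2 (RingHom.mem_ker.mpr h), h⟩

theorem RealPoint.isUnit_iff {f : ξ.LocalRing} : IsUnit f ↔ ξ.eval f ≠ 0 := by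
  refine ⟨fun h => (h.map ξ.eval).ne_zero, fun h => ?_⟩
  obtain ⟨q, g, hq, hqg⟩ := ξ.exists_mul_eq_algebraMap f
  have h1 := congrArg ξ.eval hqg
  rw [map_mul, ξ.eval_algebraMap, ξ.eval_algebraMap] at h1
  have hg : ξ g ≠ 0 := h1 ▸ mul_ne_zero h hq
  have hu := ξ.isUnit_algebraMap hg
  rw [← hqg] at hu
  exact isUnit_of_mul_isUnit_left hu

theorem RealPoint.maximalIdeal_eq :
    IsLocalRing.maximalIdeal ξ.LocalRing = RingHom.ker ξ.eval := by
  ext f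
  rw [IsLocalRing.mem_maximalIdeal, mem_nonunits_iff, ξ.isUnit_iff, not_not, RingHom.mem_ker]

/-- The polynomial functions on the plane, as elements of the local ring at `ξ`. -/
def RealPoint.ofPolynomial : MvPolynomial (Fin 2) ℝ →ₐ[ℝ] ξ.LocalRing :=
  ((IsScalarTower.toAlgHom ℝ (NormRing F) ξ.LocalRing).comp
    (IsScalarTower.toAlgHom ℝ (CoordRing F) (NormRing F))).comp (CoordRing.mk F)

theorem RealPoint.ofPolynomial_apply (f : MvPolynomial (Fin 2) ℝ) :
    ξ.ofPolynomial f = algebraMap (NormRing F) ξ.LocalRing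
      (algebraMap (CoordRing F) (NormRing F) (CoordRing.mk F f)) := rfl

theorem RealPoint.ofPolynomial_X (i : Fin 2) : ξ.ofPolynomial (X i) = ξ.localCoord i := rfl

theorem RealPoint.apply_mk (f : MvPolynomial (Fin 2) ℝ) :
    ξ (algebraMap (CoordRing F) (NormRing F) (CoordRing.mk F f)) = MvPolynomial.eval ξ.image f := by
  let ψ : MvPolynomial (Fin 2) ℝ →ₐ[ℝ] ℝ :=
    (ξ.comp (IsScalarTower.toAlgHom ℝ (CoordRing F) (NormRing F))).comp (CoordRing.mk F)
  have : ψ = aeval ξ.image := by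
    apply MvPolynomial.algHom_ext
    intro i
    rw [aeval_X]
    rfl
  exact congrArg (fun χ : MvPolynomial (Fin 2) ℝ →ₐ[ℝ] ℝ => χ f) this

theorem RealPoint.eval_ofPolynomial (f : MvPolynomial (Fin 2) ℝ) :
    ξ.eval (ξ.ofPolynomial f) = MvPolynomial.eval ξ.image f := by
  rw [ξ.ofPolynomial_apply, ξ.eval_algebraMap, ξ.apply_mk]

theorem RealPoint.ofPolynomial_self : ξ.ofPolynomial F = 0 := by
  rw [ξ.ofPolynomial_apply, CoordRing.mk_eq_zero.mpr dvd_rfl, map_zero, map_zero]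

theorem RealPoint.eval_image : MvPolynomial.eval ξ.image F = 0 := by
  rw [← ξ.eval_ofPolynomial, ξ.ofPolynomial_self, map_zero]

theorem RealPoint.ofPolynomial_eq_zero (hF : Irreducible F) {f : MvPolynomial (Fin 2) ℝ}
    (h : ξ.ofPolynomial f = 0) : F ∣ f := by
  have := NormRing.isDomain hF
  have h1 : Function.Injective (algebraMap (NormRing F) ξ.LocalRing) :=
    IsLocalization.injective _ (RingHom.ker ξ).primeCompl_le_nonZeroDivisors
  rw [ξ.ofPolynomial_apply] at h
  exact CoordRing.mk_eq_zero.mp (NormRing.algebraMap_injective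
    ((h1 (h.trans (map_zero _).symm)).trans (map_zero _).symm))

/-- The tangent coordinate as an element of the local ring. -/
def RealPoint.t : ξ.LocalRing := ξ.ofPolynomial (tangentParam F ξ.image)

/-- The normal coordinate as an element of the local ring. -/
def RealPoint.l : ξ.LocalRing := ξ.ofPolynomial (normalParam F ξ.image)

theorem RealPoint.eval_t : ξ.eval ξ.t = 0 := (ξ.eval_ofPolynomial _).trans eval_tangentParam

theorem RealPoint.localCoord_zero (hN : gradSq F ξ.image ≠ 0) :
    ξ.localCoord 0 = algebraMap ℝ ξ.LocalRing (ξ.image 0) +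
      (-MvPolynomial.eval ξ.image (pderiv 1 F)) • ξ.t +
      MvPolynomial.eval ξ.image (pderiv 0 F) • ξ.l := by
  have := congrArg ξ.ofPolynomial (X_zero_eq hN)
  rwa [map_add, map_add, map_smul, map_smul, algHom_C] at this

theorem RealPoint.localCoord_one (hN : gradSq F ξ.image ≠ 0) :
    ξ.localCoord 1 = algebraMap ℝ ξ.LocalRing (ξ.image 1) +
      MvPolynomial.eval ξ.image (pderiv 0 F) • ξ.t +
      MvPolynomial.eval ξ.image (pderiv 1 F) • ξ.l := by
  have := congrArg ξ.ofPolynomial (X_one_eq hN)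
  rwa [map_add, map_add, map_smul, map_smul, algHom_C] at this

theorem RealPoint.t_ne_zero (hF : Irreducible F) (hN : gradSq F ξ.image ≠ 0)
    (htan : HasSimpleTangentAt F ξ.image) : ξ.t ≠ 0 := fun h =>
  htan.not_dvd_tangentParam hN (ξ.ofPolynomial_eq_zero hF h)

theorem RealPoint.exists_l_eq (hN : gradSq F ξ.image ≠ 0)
    (htan : HasSimpleTangentAt F ξ.image) : ∃ v, IsUnit v ∧ ξ.l = ξ.t ^ 2 * v := by
  obtain ⟨w, v, h, hw, hv⟩ := exists_normalParam_mul_eq ξ.ofPolynomial ξ.eval ξ.ofPolynomial_self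
    ξ.eval_ofPolynomial hN htan
  obtain ⟨w', hw'⟩ := (ξ.isUnit_iff.mpr hw).exists_right_inv
  refine ⟨v * w', (ξ.isUnit_iff.mpr hv).mul (IsUnit.of_mul_eq_one w (by rw [mul_comm, hw'])), ?_⟩
  rw [← mul_assoc]
  change ξ.l * w = ξ.t ^ 2 * v at h
  rw [← h, mul_assoc, hw', mul_one]

/-- The local ring of `C` at η is already integrally closed, so functions on `X` are fractions of
functions on `C` with denominators nonzero at η. -/
theorem RealPoint.exists_mul_eq_mk (hF : Irreducible F) (hN : gradSq F ξ.image ≠ 0)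
    (htan : HasSimpleTangentAt F ξ.image) (g : NormRing F) :
    ∃ q r : CoordRing F, ξ (algebraMap _ (NormRing F) q) ≠ 0 ∧
      algebraMap (CoordRing F) (NormRing F) q * g = algebraMap _ _ r := by
  have := CoordRing.isDomain hF
  let ε : CoordRing F →ₐ[ℝ] ℝ := ξ.comp (IsScalarTower.toAlgHom ℝ (CoordRing F) (NormRing F))
  obtain ⟨w, v, h, hw, hv⟩ := exists_normalParam_mul_eq (CoordRing.mk F) ε
    (CoordRing.mk_eq_zero.mpr dvd_rfl) ξ.apply_mk hN htan
  have : (RingHom.ker ε).IsPrime := RingHom.ker_isPrime ε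
  have hint : IsIntegral (CoordRing F) (g.1 : FractionRing (CoordRing F)) := g.2
  obtain ⟨q, r, hq, hqr⟩ := exists_mul_eq_of_isIntegral (RingHom.ker ε)
    (t := CoordRing.mk F (tangentParam F ξ.image))
    (RingHom.mem_ker.mpr ((ξ.apply_mk _).trans eval_tangentParam)) (fun r hr => by
      obtain ⟨f, rfl⟩ := CoordRing.mk_surjective r
      obtain ⟨g, k, rfl⟩ := exists_eq_tangentParam_add_normalParam hN
        ((ξ.apply_mk f).symm.trans (RingHom.mem_ker.mp hr))
      -- From `l * w = t ^ 2 * v`: `w * (g * t + k * l) = t * (w * g + k * t * v)`.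
      refine ⟨w, fun h => hw (RingHom.mem_ker.mp h),
        w * CoordRing.mk F g + CoordRing.mk F k * CoordRing.mk F (tangentParam F ξ.image) * v, ?_⟩
      rw [map_add, map_mul, map_mul]
      linear_combination CoordRing.mk F k * h) hint
  exact ⟨q, r, fun h => hq (RingHom.mem_ker.mpr h), Subtype.ext hqr⟩

/-- Up to units, an element of the maximal ideal is a polynomial vanishing at η, hence a combination
of `t` and `l`, and `t` divides `l`. -/
theorem RealPoint.maximalIdeal_eq_span (hF : Irreducible F) (hN : gradSq F ξ.image ≠ 0)
    (htan : HasSimpleTangentAt F ξ.image) :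
    IsLocalRing.maximalIdeal ξ.LocalRing = Ideal.span {ξ.t} := by
  rw [ξ.maximalIdeal_eq]
  apply le_antisymm
  · intro f hf
    obtain ⟨q, g, hq, hqg⟩ := ξ.exists_mul_eq_algebraMap f
    obtain ⟨q', r, hq', hqr⟩ := ξ.exists_mul_eq_mk hF hN htan g
    obtain ⟨f', rfl⟩ := CoordRing.mk_surjective r
    obtain ⟨v, -, hv⟩ := ξ.exists_l_eq hN htan
    have hqr' := congrArg (algebraMap (NormRing F) ξ.LocalRing) hqr
    rw [map_mul, ← hqg, ← ξ.ofPolynomial_apply] at hqr'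
    have hf' : MvPolynomial.eval ξ.image f' = 0 := by
      rw [← ξ.eval_ofPolynomial, ← hqr', map_mul, map_mul, RingHom.mem_ker.mp hf, zero_mul,
        mul_zero]
    obtain ⟨a, b, rfl⟩ := exists_eq_tangentParam_add_normalParam hN hf'
    rw [Ideal.mem_span_singleton, ← (ξ.isUnit_algebraMap hq).dvd_mul_right,
      ← (ξ.isUnit_algebraMap hq').dvd_mul_left, hqr', map_add, map_mul, map_mul]
    change ξ.t ∣ _ * ξ.t + _ * ξ.l
    rw [hv]
    exact dvd_add (dvd_mul_left _ _) (((dvd_pow_self _ two_ne_zero).mul_right v).mul_left _)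
  · rw [Ideal.span_singleton_le_iff_mem]
    exact RingHom.mem_ker.mpr ξ.eval_t

theorem RealPoint.hasVal_iff (hF : Irreducible F) (hN : gradSq F ξ.image ≠ 0)
    (htan : HasSimpleTangentAt F ξ.image) {u : ξ.LocalRing} (hu : IsUnit u) {j k : ℕ} :
    ξ.HasVal (ξ.t ^ k * u) j ↔ j = k := by
  have := ξ.isDomain_localRing hF
  have ht0 := ξ.t_ne_zero hF hN htan
  have htu : ¬ IsUnit ξ.t := fun h => ξ.isUnit_iff.mp h ξ.eval_t
  rw [RealPoint.HasVal, ξ.maximalIdeal_eq_span hF hN htan, Ideal.span_singleton_pow,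
    Ideal.span_singleton_pow, Ideal.mem_span_singleton, Ideal.mem_span_singleton,
    hu.dvd_mul_right, hu.dvd_mul_right, pow_dvd_pow_iff ht0 htu, pow_dvd_pow_iff ht0 htu]
  omega

theorem RealPoint.affineValues_eq (hF : Irreducible F) (hN : gradSq F ξ.image ≠ 0)
    (htan : HasSimpleTangentAt F ξ.image) : ξ.affineValues = {0, 1, 2} := by
  have := ξ.isDomain_localRing hF
  have ht0 := ξ.t_ne_zero hF hN htan
  obtain ⟨v, hv, hl⟩ := ξ.exists_l_eq hN htan
  -- In terms of 1, `t`, `l`, of values 0, 1, 2, the value of a combination is read off from its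
  -- first nonzero coefficient.
  have hcomb : ∀ f, f ∈ Submodule.span ℝ {1, ξ.localCoord 0, ξ.localCoord 1} ↔
      ∃ a b c : ℝ, f = a • 1 + b • ξ.t + c • ξ.l := by
    intro f
    constructor
    · intro hf
      obtain ⟨a, b, c, rfl⟩ := Submodule.mem_span_triple.mp hf
      rw [ξ.localCoord_zero hN, ξ.localCoord_one hN, Algebra.algebraMap_eq_smul_one,
        Algebra.algebraMap_eq_smul_one]
      refine ⟨a + b * ξ.image 0 + c * ξ.image 1,
        -b * MvPolynomial.eval ξ.image (pderiv 1 F) + c * MvPolynomial.eval ξ.image (pderiv 0 F),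
        b * MvPolynomial.eval ξ.image (pderiv 0 F) + c * MvPolynomial.eval ξ.image (pderiv 1 F),
        ?_⟩
      module
    · rintro ⟨a, b, c, rfl⟩
      have h1 : (1 : ξ.LocalRing) ∈
          Submodule.span ℝ {1, ξ.localCoord 0, ξ.localCoord 1} :=
        Submodule.subset_span (by simp)
      have hx : ξ.localCoord 0 ∈ Submodule.span ℝ {1, ξ.localCoord 0, ξ.localCoord 1} :=
        Submodule.subset_span (by simp)
      have hy : ξ.localCoord 1 ∈ Submodule.span ℝ {1, ξ.localCoord 0, ξ.localCoord 1} :=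
        Submodule.subset_span (by simp)
      have ht : ξ.t = (gradSq F ξ.image)⁻¹ • ((-MvPolynomial.eval ξ.image (pderiv 1 F)) •
          (ξ.localCoord 0 - ξ.image 0 • 1) +
          MvPolynomial.eval ξ.image (pderiv 0 F) • (ξ.localCoord 1 - ξ.image 1 • 1)) := by
        simp only [RealPoint.t, tangentParam, map_mul, map_add, map_sub, map_neg, algHom_C,
          ξ.ofPolynomial_X, Algebra.smul_def, mul_one]
      have hl' : ξ.l = (gradSq F ξ.image)⁻¹ • (MvPolynomial.eval ξ.image (pderiv 0 F) •
          (ξ.localCoord 0 - ξ.image 0 • 1) +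
          MvPolynomial.eval ξ.image (pderiv 1 F) • (ξ.localCoord 1 - ξ.image 1 • 1)) := by
        simp only [RealPoint.l, normalParam, map_mul, map_add, map_sub, algHom_C,
          ξ.ofPolynomial_X, Algebra.smul_def, mul_one]
      have hx' := Submodule.sub_mem _ hx (Submodule.smul_mem _ (ξ.image 0) h1)
      have hy' := Submodule.sub_mem _ hy (Submodule.smul_mem _ (ξ.image 1) h1)
      rw [ht, hl']
      exact add_mem (add_mem (Submodule.smul_mem _ _ h1) (Submodule.smul_mem _ _
        (Submodule.smul_mem _ _ (add_mem (Submodule.smul_mem _ _ hx')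
          (Submodule.smul_mem _ _ hy'))))) (Submodule.smul_mem _ _
        (Submodule.smul_mem _ _ (add_mem (Submodule.smul_mem _ _ hx')
          (Submodule.smul_mem _ _ hy'))))
  have hval := fun {u : ξ.LocalRing} (hu : IsUnit u) {j k : ℕ} =>
    ξ.hasVal_iff hF hN htan hu (j := j) (k := k)
  ext k
  simp only [RealPoint.affineValues, Set.mem_ofPred_eq, Set.mem_insert_iff,
    Set.mem_singleton_iff, hcomb]
  constructor
  · rintro ⟨_, ⟨a, b, c, rfl⟩, hf0, hf⟩
    by_cases ha : a = 0
    · subst ha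
      by_cases hb : b = 0
      · subst hb
        have hc : c ≠ 0 := by rintro rfl; simp at hf0
        have hu : IsUnit (algebraMap ℝ ξ.LocalRing c * v) :=
          ((isUnit_iff_ne_zero.mpr hc).map _).mul hv
        have he : (0 : ℝ) • (1 : ξ.LocalRing) + (0 : ℝ) • ξ.t + c • ξ.l =
            ξ.t ^ 2 * (algebraMap ℝ ξ.LocalRing c * v) := by
          rw [hl, zero_smul, zero_smul, Algebra.smul_def]; ring
        rw [he, hval hu] at hf
        exact Or.inr (Or.inr hf)
      · have hu : IsUnit (algebraMap ℝ ξ.LocalRing b + ξ.t * (algebraMap ℝ ξ.LocalRing c * v)) :=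
          ξ.isUnit_iff.mpr (by simpa [ξ.eval_t] using hb)
        have he : (0 : ℝ) • (1 : ξ.LocalRing) + b • ξ.t + c • ξ.l = ξ.t ^ 1 *
            (algebraMap ℝ ξ.LocalRing b + ξ.t * (algebraMap ℝ ξ.LocalRing c * v)) := by
          rw [hl, zero_smul, Algebra.smul_def, Algebra.smul_def]; ring
        rw [he, hval hu] at hf
        exact Or.inr (Or.inl hf)
    · have hu : IsUnit (a • (1 : ξ.LocalRing) + b • ξ.t + c • ξ.l) :=
        ξ.isUnit_iff.mpr (by simpa [ξ.eval_t, hl] using ha)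
      exact Or.inl ((hval hu (k := 0)).mp (by rwa [pow_zero, one_mul]))
  · rintro (rfl | rfl | rfl)
    · refine ⟨1, ⟨1, 0, 0, by simp⟩, one_ne_zero, ?_⟩
      simpa using (hval isUnit_one (j := 0) (k := 0)).mpr rfl
    · refine ⟨ξ.t, ⟨0, 1, 0, by simp⟩, ht0, ?_⟩
      simpa using (hval isUnit_one (j := 1) (k := 1)).mpr rfl
    · refine ⟨ξ.l, ⟨0, 0, 1, by simp⟩, ?_, ?_⟩
      · rw [hl]
        exact mul_ne_zero (pow_ne_zero _ ht0) hv.ne_zero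
      · rw [hl, hval hv]

theorem RealPoint.t_notMem_ker_sq (hF : Irreducible F) (hN : gradSq F ξ.image ≠ 0)
    (htan : HasSimpleTangentAt F ξ.image) : ξ.t ∉ RingHom.ker ξ.eval ^ 2 := by
  have h := ((ξ.hasVal_iff hF hN htan isUnit_one (j := 1) (k := 1)).mpr rfl).2
  rwa [mul_one, pow_one, ξ.maximalIdeal_eq] at h

end LocalRing

end PlaneCurve

end

theorem mainTheorem5 (F : MvPolynomial (Fin 2) ℝ) (hF : Irreducible F)
    (ξ : PlaneCurve.RealPoint F)
    (hns : PlaneCurve.IsNonsingularAt F ξ.image)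
    (htan : PlaneCurve.HasSimpleTangentAt F ξ.image) :
    ξ.affineValues = {0, 1, 2} ∧
    ∀ (s : ξ.LocalRing) (hs : PlaneCurve.IsFreeGenerator s),
      ∃ (u₁ u₂ : ξ.LocalRing) (α β : ξ.LocalRing ⊗[ℝ] ξ.LocalRing),
        (PlaneCurve.tangentTensor hs (ξ.localCoord 0) (ξ.localCoord 1) =
            α * PlaneCurve.delta u₁ ^ 2 + β * PlaneCurve.delta u₂ ^ 2 ∨
          -PlaneCurve.tangentTensor hs (ξ.localCoord 0) (ξ.localCoord 1) =
            α * PlaneCurve.delta u₁ ^ 2 + β * PlaneCurve.delta u₂ ^ 2) ∧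
        0 < ξ.residue α ∧ 0 < ξ.residue β := by
  have hN := hns.gradSq_ne_zero
  refine ⟨ξ.affineValues_eq hF hN htan, fun s hs => ?_⟩
  obtain ⟨a, b, c, hT⟩ := PlaneCurve.exists_isTaylor F
  have hx : MvPolynomial.aeval ξ.localCoord F = 0 := by
    have h := MvPolynomial.comp_aeval_apply (R := ℝ) MvPolynomial.X ξ.ofPolynomial F
    rw [MvPolynomial.aeval_X_left_apply, ξ.ofPolynomial_self] at h
    exact h.symm
  exact PlaneCurve.exists_tangentTensor_eq ξ.eval (fun f hf => ξ.isUnit_iff.mpr hf) hx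
    (fun i => ξ.eval_algebraMap _) hT (htan.tangentCoeff_ne_zero ξ.eval_image hT) hN
    (ξ.localCoord_zero hN) (ξ.localCoord_one hN) hs
    (PlaneCurve.eval_derivWrt_ne_zero ξ.eval hs ξ.eval_t (ξ.t_notMem_ker_sq hF hN htan))
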